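/- \textbf{Setting.} Let $X$ be a Polish space with its Borel $\sigma$-algebra and let $\mathcal H$ be a set of functions $X\to\{0,1\}$. Assume that $X$ is countable (so that every subset of $X$ is Borel), or that $\mathcal H=\{g(\theta,\cdot):\theta\in\Theta\}$ for some Polish space $\Theta$ and some Borel measurable map $g:\Theta\times X\to\{0,1\}$. \textbf{PEC learning.} For a probability measure $D$ on $X\times\{0,1\}$ and $h:X\to\{0,1\}$ let $L_D(h)=\Pr_{(x,y)\sim D}[h(x)\ne y]$ (for a non-measurable $h$, the outer measure of the error set). $D$ is realizable by $\mathcal H$ if $\inf_{h\in\mathcal H}L_D(h)=0$ (so no $D$ is realizable by the empty class). A learning rule $\mathcal A$ maps each finite labelled sample in $\bigcup_n (X\times\{0,1\})^n$ to a function $X\to\{0,1\}$. It is a PEC learner for $\mathcal H$ if for every $D$ realizable by $\mathcal H$ and an infinite i.i.d. sequence $z_1,z_2,\dots$ drawn from $D$, almost surely there is an $N$ such that $L_D(\mathcal A(z_1,\dots,z_n))=0$ for all $n\ge N$. $\mathcal H$ is PEC learnable if it has a PEC learner. \textbf{Trees.} $\mathcal H$ shatters an infinite Littlestone tree if there are points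 $x_\eta\in X$, one for each finite word $\eta$ over $\{0,1\}$, such that for every finite word $\rho$ there is an $h\in\mathcal H$ with $h(x_\eta)=i$ whenever $\eta^\frown\langle i\rangle$ is an initial segment of $\rho$. \textbf{Ordinal SOA.} For an ordinal $\alpha$ and $\mathcal G\subseteq\mathcal H$ say recursively that $\operatorname{Ldim}(\mathcal G)\ge\alpha$ if $\mathcal G\neq\emptyset$ and for each $\beta<\alpha$ there is an $x\in X$ with $\operatorname{Ldim}(\{h\in\mathcal G:h(x)=y\})\ge\beta$ for both $y\in\{0,1\}$. The ordinal Littlestone dimension $\operatorname{Ldim}(\mathcal G)$ is the largest $\alpha$ with $\operatorname{Ldim}(\mathcal G)\ge\alpha$; it is $-1$ if $\mathcal G=\emptyset$, and undefined if $\operatorname{Ldim}(\mathcal G)\ge\alpha$ for every $\alpha$. For a finite sample $S$ let $\mathcal H_S=\{h\in\mathcal H: h(x)=y \text{ for all } (x,y)\in S\}$. The ordinal SOA is the learning rule that on input $S$ outputs the function $x\mapsto y_x$, where $y_x\in\{0,1\}$ is the $y$ for which $\operatorname{Ldim}(\mathcal H_{S\cup\{(x,y)\}})$ is maximal, and $y_x=1$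 if there is a tie or if one of the two dimensions is undefined. \textbf{Theorem (PEC Learning).} The following are equivalent: \begin{enumerate} \item $\mathcal H$ is PEC learnable; \item $\mathcal H$ does not shatter an infinite Littlestone tree. \end{enumerate} Moreover, whenever $\mathcal H$ satisfies these conditions, the ordinal SOA is a PEC learner for $\mathcal H$, and it is universally measurable: for each $n$ the map $(S,x)\mapsto y_x$ on $(X\times\{0,1\})^n\times X$ is measurable with respect to the completion of every finite Borel measure. -/

import Mathlib

open MeasureTheory

universe u v

/-- The subclass of the hypotheses `h ∈ H` with `h x = y`. Hypotheses are functions `X → Bool`;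
`false` is the label `0` and `true` is the label `1`. -/
def restrictClass {X : Type u} (H : Set (X → Bool)) (x : X) (y : Bool) : Set (X → Bool) :=
  {h | h ∈ H ∧ h x = y}

/-- The subclass `H_S` of the hypotheses in `H` that agree with every example of the sample `S`. -/
def versionSpace {X : Type u} (H : Set (X → Bool)) {n : ℕ} (S : Fin n → X × Bool) :
    Set (X → Bool) :=
  {h | h ∈ H ∧ ∀ i, h (S i).1 = (S i).2}

/-- `H` shatters an infinite Littlestone tree: the nodes of the complete infinite binary tree (the
finite words over `{0, 1}`) can be labelled by points of `X` so that every finite walk from the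
root agrees with some `h ∈ H`. The `k`-th step of the walk `p` leaves the node `p.take k` in the
direction `p[k]`. -/
def ShattersInfiniteLittlestoneTree {X : Type u} (H : Set (X → Bool)) : Prop :=
  ∃ t : List Bool → X, ∀ p : List Bool, ∃ h ∈ H,
    ∀ (k : ℕ) (hk : k < p.length), h (t (p.take k)) = p[k]

/-- `H` has ordinal Littlestone dimension at least `α`: it is nonempty, and for each `β < α` there
is a point `x` for which both `{h ∈ H | h x = 0}` and `{h ∈ H | h x = 1}` have ordinal Littlestone
dimension at least `β`. -/
def LdimGE {X : Type u} (α : Ordinal.{u}) (H : Set (X → Bool)) : Prop :=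
  H.Nonempty ∧ ∀ β : Ordinal.{u}, β < α → ∃ x : X, ∀ y : Bool, LdimGE β (restrictClass H x y)
termination_by α

open Classical in
/-- The ordinal Littlestone dimension. The bottom element plays the role of `-1`, the value at the
empty class, and the top element means that the dimension is undefined. -/
noncomputable def ordinalLdim {X : Type u} (H : Set (X → Bool)) :
    WithBot (WithTop Ordinal.{u}) :=
  if H = ∅ then ⊥
  else if ∀ α : Ordinal.{u}, LdimGE α H then ⊤
  else ((sSup {α : Ordinal.{u} | LdimGE α H} : Ordinal.{u}) : WithTop Ordinal.{u})

/-- A (deterministic) learning rule maps each finite labelled sample to a hypothesis. -/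
abbrev LearningRule (X : Type u) : Type u :=
  ∀ n : ℕ, (Fin n → X × Bool) → X → Bool

open Classical in
/-- The ordinal standard optimal algorithm. On the sample `S` it labels `x` by the `y` for which
the ordinal Littlestone dimension of `H_{S ∪ {(x, y)}}` is maximal, and by `1` if there is a tie or
if one of the two dimensions is undefined. -/
noncomputable def ordinalSOA {X : Type u} (H : Set (X → Bool)) : LearningRule X :=
  fun _ S x =>
    if ordinalLdim (restrictClass (versionSpace H S) x false) ≠ ⊤ ∧
        ordinalLdim (restrictClass (versionSpace H S) x true) <
          ordinalLdim (restrictClass (versionSpace H S) x false)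
    then false else true

/-- The loss `L_D(h)`, the probability of `h x ≠ y` for `(x, y)` drawn from `D`. -/
noncomputable def loss {X : Type u} [MeasurableSpace X] (D : Measure (X × Bool)) (h : X → Bool) :
    ENNReal :=
  D {z | h z.1 ≠ z.2}

/-- `D` is realizable by `H`: the infimum of the loss over `H` is zero. (For empty `H` the infimum
is `∞`.) -/
def IsRealizable {X : Type u} [MeasurableSpace X] (H : Set (X → Bool)) (D : Measure (X × Bool)) :
    Prop :=
  ⨅ h ∈ H, loss D h = 0

/-- `A` is a PEC learner for `H`: for every distribution `D` that is realizable by `H`, almost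
surely over an infinite i.i.d. sequence `z` from `D`, the hypotheses that `A` outputs on the
prefixes of `z` eventually all have zero loss. -/
def IsPECLearner {X : Type u} [MeasurableSpace X] (A : LearningRule X) (H : Set (X → Bool)) :
    Prop :=
  ∀ (D : Measure (X × Bool)) [IsProbabilityMeasure D], IsRealizable H D →
    ∀ᵐ z ∂(Measure.infinitePi fun _ : ℕ => D),
      ∃ N : ℕ, ∀ n ≥ N, loss D (A n fun i : Fin n => z i) = 0

/-- `H` is PEC learnable. -/
def PECLearnable {X : Type u} [MeasurableSpace X] (H : Set (X → Bool)) : Prop :=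
  ∃ A : LearningRule X, IsPECLearner A H

/-- Each of the maps `(S, x) ↦ A(S)(x)` is universally measurable. -/
def LearningRule.UniversallyMeasurable {X : Type u} [MeasurableSpace X] (A : LearningRule X) :
    Prop :=
  ∀ (n : ℕ) (μ : Measure ((Fin n → X × Bool) × X)) [IsFiniteMeasure μ],
    NullMeasurable (fun q => A n q.1 q.2) μ

/-- The image admissible Suslin property: `H = {g(θ, ·) | θ ∈ Θ}` for a Polish space `Θ` and a
Borel measurable map `g : Θ × X → {0, 1}`. -/
def HasMeasurableParametrization {X : Type u} [MeasurableSpace X] (H : Set (X → Bool)) : Prop :=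
  ∃ (Θ : Type v) (_ : TopologicalSpace Θ) (_ : PolishSpace Θ) (_ : MeasurableSpace Θ)
    (_ : BorelSpace Θ) (g : Θ × X → Bool),
    Measurable g ∧ H = Set.range fun (θ : Θ) (x : X) => g (θ, x)

/-! If `H` shatters a tree, toss fair coins to choose a branch and draw the sample at random depths
along it. At a depth beyond all sampled depths the label is a fresh coin toss, so the rule errs
there with probability `1/2`, for every `n`. Hence it errs infinitely often with probability at
least `1/2`, and Fubini gives one branch that defeats the rule (`exists_branch_not_ae_eventually`).
Every depth has positive mass, so each such error means positive loss.

If `H` shatters no tree, its dimension is an ordinal, and a labelled point on which the SOA errs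
strictly lowers the dimension of the version space. Along a sequence of examples these dimensions
attain a minimum. From then on the set of examples that would lower the dimension must be null:
otherwise a later example would fall in it (`ae_exists_mem_section`) and push the dimension below
the minimum. This null set contains the errors of the SOA.

This argument needs the dimension-lowering sets to be null measurable. For a countable `α`, the
samples whose version space has dimension at least `α` form an analytic set when `H` is
parametrized. Countable ordinals suffice: a parametrized class with dimension at least every
countable ordinal already shatters a tree
(`shattersInfiniteLittlestoneTree_of_forall_lt_omega_one`). There, finite trees are coded by points
of Baire space, and codes with stabilizing coordinates converge to a code of an infinite tree. -/

/-! ### Universal measurability of analytic sets -/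

open Set Filter Topology in
/-- The points common to the closures of the images of the sets `{c | ∀ i < n, c i ≤ b i}` lie in the
range of `f`. -/
theorem iInter_closure_image_subset_range {α : Type*} [TopologicalSpace α] [T2Space α]
    {f : (ℕ → ℕ) → α} (hf : Continuous f) (b : ℕ → ℕ) :
    ⋂ n, closure (f '' {c | ∀ i < n, c i ≤ b i}) ⊆ range f := by
  intro x hx
  rw [mem_iInter] at hx
  let C : ℕ → Set (ℕ → ℕ) := fun n => {c | ∀ i < n, c i ≤ b i}
  have hC : Antitone C := fun m n hmn c hc i hi => hc i (hi.trans_le hmn)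
  have hne : (comap f (𝓝 x) ⊓ ⨅ n, 𝓟 (C n)).NeBot := by
    rw [((𝓝 x).basis_sets.comap f).inf
      (hasBasis_iInf_principal (s := C) (directed_of_isDirected_le hC)) |>.neBot_iff]
    rintro ⟨U, n⟩ ⟨hU, -⟩
    obtain ⟨_, hyU, c, hc, rfl⟩ := mem_closure_iff_nhds.1 (hx n) U hU
    exact ⟨c, hyU, hc⟩
  let G := Ultrafilter.of (comap f (𝓝 x) ⊓ ⨅ n, 𝓟 (C n))
  have hG : (G : Filter (ℕ → ℕ)) ≤ comap f (𝓝 x) ⊓ ⨅ n, 𝓟 (C n) := Ultrafilter.of_le _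
  -- Coordinate `i` is bounded by `b i` along `G`, so it stays in a finite set and converges. The
  -- limit point is a preimage of `x`.
  have hlim : ∀ i, ∃ a, Tendsto (fun c : ℕ → ℕ => c i) G (𝓝 a) := by
    intro i
    obtain ⟨a, -, ha⟩ := (finite_Iic (b i)).isCompact.ultrafilter_le_nhds
      (G.map fun c : ℕ → ℕ => c i) (by
        rw [le_principal_iff, Ultrafilter.coe_map]
        have : C (i + 1) ∈ (G : Filter (ℕ → ℕ)) :=
          hG (mem_inf_of_right (mem_iInf_of_mem (i + 1) (mem_principal_self _)))
        exact mem_map.2 (mem_of_superset this fun c (hc : ∀ j < i + 1, c j ≤ b j) =>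
          hc i (Nat.lt_succ_self i)))
    exact ⟨a, ha⟩
  choose a ha using hlim
  have h₁ : Tendsto f G (𝓝 (f a)) := (hf.tendsto a).comp (tendsto_pi_nhds.2 ha)
  have h₂ : Tendsto f G (𝓝 x) := tendsto_iff_comap.2 (hG.trans inf_le_left)
  exact ⟨a, tendsto_nhds_unique h₁ h₂⟩

open Set Filter Topology in
/-- An analytic set can be approximated in measure from inside by closed sets. -/
theorem MeasureTheory.AnalyticSet.exists_isClosed_subset_le {α : Type*} [TopologicalSpace α]
    [T2Space α] [MeasurableSpace α] [OpensMeasurableSpace α] {s : Set α} (hs : AnalyticSet s)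
    (μ : Measure α) [IsFiniteMeasure μ] {r : ENNReal} (hr : r < μ s) :
    ∃ t ⊆ s, IsClosed t ∧ r ≤ μ t := by
  rw [AnalyticSet] at hs
  rcases hs with rfl | ⟨f, hf, rfl⟩
  · simp at hr
  -- Bounding one more coordinate by a large enough `m` keeps the measure of the image above `r`.
  have step : ∀ (n : ℕ) (D : Set (ℕ → ℕ)), r < μ (f '' D) →
      ∃ m, r < μ (f '' (D ∩ {c | c n ≤ m})) := by
    intro n D hD
    have hU : f '' D = ⋃ m, f '' (D ∩ {c | c n ≤ m}) := by
      rw [← image_iUnion, ← inter_iUnion]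
      congr 1
      refine (inter_eq_left.2 fun c _ => mem_iUnion.2 ⟨c n, le_refl (c n)⟩).symm
    rw [hU, Monotone.measure_iUnion] at hD
    · exact lt_iSup_iff.1 hD
    · exact fun m m' h => image_mono (inter_subset_inter_right _ fun c hc => le_trans hc h)
  choose! m hm using step
  let D : ℕ → Set (ℕ → ℕ) := fun n => Nat.rec univ (fun n E => E ∩ {c | c n ≤ m n E}) n
  have hD : ∀ n, r < μ (f '' D n) := by
    intro n
    induction n with
    | zero => simpa [D] using hr
    | succ n ih => exact hm n _ ih
  have hDC : ∀ n, D n ⊆ {c | ∀ i < n, c i ≤ m i (D i)} := by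
    intro n
    induction n with
    | zero => intro c _ i hi; omega
    | succ n ih =>
      rintro c ⟨hc, hcn⟩ i hi
      rcases Nat.lt_succ_iff_lt_or_eq.1 hi with hi | rfl
      · exact ih hc i hi
      · exact hcn
  refine ⟨_, iInter_closure_image_subset_range hf fun i => m i (D i),
    isClosed_iInter fun n => isClosed_closure, ?_⟩
  rw [Antitone.measure_iInter]
  · exact le_iInf fun n => (hD n).le.trans (measure_mono ((image_mono (hDC n)).trans subset_closure))
  · exact fun n n' h => closure_mono (image_mono fun c hc i hi => hc i (hi.trans_le h))
  · exact fun n => isClosed_closure.measurableSet.nullMeasurableSet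
  · exact ⟨0, measure_ne_top _ _⟩

/-- Analytic sets are universally measurable. -/
theorem MeasureTheory.AnalyticSet.nullMeasurableSet {α : Type*} [TopologicalSpace α]
    [T2Space α] [MeasurableSpace α] [OpensMeasurableSpace α] {s : Set α} (hs : AnalyticSet s)
    (μ : Measure α) [IsFiniteMeasure μ] : NullMeasurableSet s μ := by
  rcases eq_or_ne (μ s) 0 with h0 | h0
  · exact NullMeasurableSet.of_null h0
  obtain ⟨r, -, hr, hlim⟩ := exists_seq_strictMono_tendsto' (pos_iff_ne_zero.2 h0)
  choose t hts htc hrt using fun n => hs.exists_isClosed_subset_le μ (hr n).2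
  have hm : MeasurableSet (⋃ n, t n) := .iUnion fun n => (htc n).measurableSet
  have hle : μ s ≤ μ (⋃ n, t n) :=
    le_of_tendsto' hlim fun n => (hrt n).trans (measure_mono (Set.subset_iUnion t n))
  exact hm.nullMeasurableSet.congr (ae_eq_of_subset_of_measure_ge (Set.iUnion_subset hts) hle
    hm.nullMeasurableSet (measure_ne_top _ _))

/-! ### Ordinal Littlestone dimension and infinite trees -/

section Ldim

variable {X : Type u} {H G : Set (X → Bool)} {α β : Ordinal.{u}}

theorem ldimGE_iff : LdimGE α H ↔
    H.Nonempty ∧ ∀ β < α, ∃ x : X, ∀ y : Bool, LdimGE β (restrictClass H x y) := by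
  rw [LdimGE]

theorem LdimGE.nonempty (h : LdimGE α H) : H.Nonempty := (ldimGE_iff.1 h).1

theorem LdimGE.of_le (h : LdimGE α H) (hβ : β ≤ α) : LdimGE β H :=
  ldimGE_iff.2 ⟨h.nonempty, fun γ hγ => (ldimGE_iff.1 h).2 γ (hγ.trans_le hβ)⟩

theorem restrictClass_mono (h : G ⊆ H) (x : X) (y : Bool) :
    restrictClass G x y ⊆ restrictClass H x y := fun _ hg => ⟨h hg.1, hg.2⟩

theorem LdimGE.mono (h : LdimGE α G) (hGH : G ⊆ H) : LdimGE α H := by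
  induction α using WellFoundedLT.induction generalizing G H with
  | ind α ih =>
    refine ldimGE_iff.2 ⟨h.nonempty.mono hGH, fun β hβ => ?_⟩
    obtain ⟨x, hx⟩ := (ldimGE_iff.1 h).2 β hβ
    exact ⟨x, fun y => ih β hβ (hx y) (restrictClass_mono hGH x y)⟩

theorem ldimGE_succ : LdimGE (Order.succ α) H ↔ ∃ x, ∀ y, LdimGE α (restrictClass H x y) := by
  constructor
  · exact fun h => (ldimGE_iff.1 h).2 α (Order.lt_succ α)
  · rintro ⟨x, hx⟩
    refine ldimGE_iff.2 ⟨(hx true).nonempty.mono fun h hh => hh.1, fun β hβ => ⟨x, fun y => ?_⟩⟩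
    exact (hx y).of_le (Order.lt_succ_iff.1 hβ)

theorem ordinalLdim_eq_top : ordinalLdim H = ⊤ ↔ ∀ α, LdimGE α H := by
  unfold ordinalLdim
  split_ifs with h h'
  · simp only [bot_ne_top, false_iff, h]
    exact fun h => (h 0).nonempty.ne_empty rfl
  · simpa using h'
  · simp only [h', iff_false]
    exact fun h => WithTop.coe_ne_top (WithBot.coe_injective h)

/-- The supremum in the definition is attained, because `LdimGE` at an ordinal only tests strictly
smaller ones. -/
theorem coe_le_ordinalLdim :
    ((α : WithTop Ordinal.{u}) : WithBot (WithTop Ordinal.{u})) ≤ ordinalLdim H ↔ LdimGE α H := by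
  unfold ordinalLdim
  split_ifs with h h'
  · simp only [le_bot_iff, WithBot.coe_ne_bot, false_iff, h]
    exact fun h => h.nonempty.ne_empty rfl
  · simpa using h' α
  · push Not at h'
    obtain ⟨γ, hγ⟩ := h'
    have hbdd : BddAbove {α : Ordinal.{u} | LdimGE α H} :=
      ⟨γ, fun α hα => le_of_not_gt fun hlt => hγ (LdimGE.of_le hα hlt.le)⟩
    rw [WithBot.coe_le_coe, WithTop.coe_le_coe]
    refine ⟨fun hα => LdimGE.of_le ?_ hα, fun hα => le_csSup hbdd hα⟩
    refine ldimGE_iff.2 ⟨Set.nonempty_iff_ne_empty.2 h, fun β hβ => ?_⟩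
    obtain ⟨δ, hδ, hβδ⟩ := exists_lt_of_lt_csSup' hβ
    exact (ldimGE_iff.1 hδ).2 β hβδ

theorem ordinalLdim_lt_ordinalLdim :
    ordinalLdim G < ordinalLdim H ↔ ∃ α, LdimGE α H ∧ ¬ LdimGE α G := by
  constructor
  · intro h
    simp only [← coe_le_ordinalLdim, not_le]
    generalize ordinalLdim G = a at h
    generalize ordinalLdim H = b at h
    induction b using WithBot.recBotCoe with
    | bot => simp at h
    | coe b =>
      induction b using WithTop.recTopCoe with
      | coe b => exact ⟨b, le_rfl, h⟩
      | top =>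
        induction a using WithBot.recBotCoe with
        | bot => exact ⟨0, le_top, WithBot.bot_lt_coe _⟩
        | coe a =>
          induction a using WithTop.recTopCoe with
          | top => exact absurd h (lt_irrefl _)
          | coe a =>
            refine ⟨Order.succ a, le_top, ?_⟩
            rw [WithBot.coe_lt_coe, WithTop.coe_lt_coe]
            exact Order.lt_succ a
  · rintro ⟨α, hH, hG⟩
    rw [← coe_le_ordinalLdim] at hH hG
    exact (not_le.1 hG).trans_le hH

theorem ordinalLdim_mono (h : G ⊆ H) : ordinalLdim G ≤ ordinalLdim H := by
  rw [← not_lt, ordinalLdim_lt_ordinalLdim]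
  rintro ⟨α, hG, hH⟩
  exact hH (hG.mono h)

/-- At each point, one of the two restrictions of a nonempty class of bounded dimension has a smaller
dimension than the class. -/
theorem exists_ordinalLdim_restrictClass_lt (hne : H.Nonempty) (hα : ¬ LdimGE α H) (x : X) :
    ∃ y, ordinalLdim (restrictClass H x y) < ordinalLdim H := by
  by_contra! h
  -- If neither restriction at `x` loses dimension, the same `x` serves as witness at every level.
  have hall : ∀ β, LdimGE β H := by
    intro β
    induction β using WellFoundedLT.induction with
    | ind β ih =>
      refine ldimGE_iff.2 ⟨hne, fun γ hγ => ⟨x, fun y => ?_⟩⟩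
      exact coe_le_ordinalLdim.1 ((coe_le_ordinalLdim.2 (ih γ hγ)).trans (h y))
  exact hα (hall α)

/-- Whenever the ordinal SOA errs on an example, this example decreases the dimension of the version
space. -/
theorem ordinalLdim_restrictClass_lt_of_ordinalSOA_ne {n : ℕ} {S : Fin n → X × Bool}
    (hne : (versionSpace H S).Nonempty) (hα : ¬ LdimGE α H) {x : X} {y : Bool}
    (hy : ordinalSOA H n S x ≠ y) :
    ordinalLdim (restrictClass (versionSpace H S) x y) < ordinalLdim (versionSpace H S) := by
  have hV : ¬ LdimGE α (versionSpace H S) := fun h => hα (h.mono fun _ hh => hh.1)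
  have hfalse : ordinalLdim (restrictClass (versionSpace H S) x false) ≠ ⊤ := fun h =>
    hV ((ordinalLdim_eq_top.1 h α).mono fun _ hh => hh.1)
  -- The label rejected by the rule has the smaller of the two dimensions, so at most that of the
  -- label `b`.
  obtain ⟨b, hb⟩ := exists_ordinalLdim_restrictClass_lt hne hV x
  refine lt_of_le_of_lt ?_ hb
  unfold ordinalSOA at hy
  split_ifs at hy with h
  · obtain rfl : y = true := by simpa using hy.symm
    cases b
    · exact h.2.le
    · exact le_rfl
  · obtain rfl : y = false := by simpa using hy.symm
    cases b
    · exact le_rfl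
    · exact not_lt.1 fun hlt => h ⟨hfalse, hlt⟩

/-- A class whose dimension is undefined has a point for which the dimensions of both restrictions
are undefined. -/
theorem exists_forall_ldimGE_restrictClass (h : ∀ α, LdimGE α H) :
    ∃ x, ∀ y, ∀ α, LdimGE α (restrictClass H x y) := by
  by_contra! hx
  choose y α hα using hx
  -- The failing ordinals are indexed by `X`, hence have a supremum in the same universe.
  obtain ⟨x, hx⟩ := ldimGE_succ.1 (h (Order.succ (⨆ x, α x)))
  exact hα x ((hx (y x)).of_le (Ordinal.le_iSup α x))

/-- A class whose dimension is undefined shatters an infinite Littlestone tree. -/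
theorem shattersInfiniteLittlestoneTree_of_forall_ldimGE (h : ∀ α, LdimGE α H) :
    ShattersInfiniteLittlestoneTree H := by
  have : Nonempty X := ⟨(exists_forall_ldimGE_restrictClass h).choose⟩
  choose! x hx using fun (G : Set (X → Bool)) (hG : ∀ α, LdimGE α G) =>
    exists_forall_ldimGE_restrictClass hG
  let C : List Bool → Set (X → Bool) := fun p =>
    p.reverseRecOn H fun _ y G => restrictClass G (x G) y
  have hsnoc : ∀ p y, C (p ++ [y]) = restrictClass (C p) (x (C p)) y := fun p y => by
    simp only [C, List.reverseRecOn_concat]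
  have hC : ∀ p α, LdimGE α (C p) := by
    intro p
    induction p using List.reverseRecOn with
    | nil => simpa [C] using h
    | append_singleton p y ih => rw [hsnoc]; exact hx _ ih y
  have hmem : ∀ p, ∀ f ∈ C p, f ∈ H ∧
      ∀ (k : ℕ) (hk : k < p.length), f (x (C (p.take k))) = p[k] := by
    intro p
    induction p using List.reverseRecOn with
    | nil => intro f hf; exact ⟨by simpa [C] using hf, fun k hk => absurd hk (by simp)⟩
    | append_singleton p y ih =>
      intro f hf
      rw [hsnoc] at hf
      obtain ⟨hfH, hfp⟩ := ih f hf.1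
      refine ⟨hfH, fun k hk => ?_⟩
      rcases lt_or_ge k p.length with hkp | hkp
      · rw [List.take_append_of_le_length hkp.le, List.getElem_append_left hkp]
        exact hfp k hkp
      · obtain rfl : k = p.length := by simp at hk; omega
        simpa using hf.2
  refine ⟨fun p => x (C p), fun p => ?_⟩
  obtain ⟨f, hf⟩ := (hC p 0).nonempty
  exact ⟨f, (hmem p f hf).1, (hmem p f hf).2⟩

theorem exists_not_ldimGE (h : ¬ ShattersInfiniteLittlestoneTree H) : ∃ α, ¬ LdimGE α H := by
  by_contra! h'
  exact h (shattersInfiniteLittlestoneTree_of_forall_ldimGE h')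

end Ldim

/-! ### Classes of uncountable dimension shatter an infinite tree -/

section CountableBound

open Ordinal

/-- If for each countable ordinal some index satisfies a downward closed property, and there are
countably many indices, then some index satisfies it at all countable ordinals. -/
theorem exists_forall_lt_omega_one {ι : Type v} [Countable ι] {Q : ι → Ordinal.{u} → Prop}
    (hQ : ∀ i α β, β ≤ α → Q i α → Q i β) (h : ∀ α < ω₁, ∃ i, Q i α) :
    ∃ i, ∀ α < ω₁, Q i α := by
  by_contra! hn
  choose α hα hQα using hn
  rcases isEmpty_or_nonempty ι with hι | hι
  · obtain ⟨i, -⟩ := h 0 (omega0_pos.trans omega0_lt_omega_one)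
    exact hι.false i
  obtain ⟨e, he⟩ := exists_surjective_nat ι
  obtain ⟨i, hi⟩ := h (⨆ n, α (e n)) (Ordinal.iSup_lt_omega_one fun n => hα (e n))
  obtain ⟨n, rfl⟩ := he i
  exact hQα _ (hQ _ _ _ (Ordinal.le_iSup (fun n => α (e n)) n) hi)

theorem succ_lt_omega_one {α : Ordinal.{u}} (h : α < ω₁) : Order.succ α < ω₁ :=
  (Cardinal.isSuccLimit_omega 1).succ_lt h

theorem countable_Iio_of_lt_omega_one {α : Ordinal.{u}} (h : α < ω₁) : Countable (Set.Iio α) := by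
  rw [← Cardinal.mk_le_aleph0_iff, Cardinal.mk_Iio_ordinal, Cardinal.lift_le_aleph0,
    ← Order.lt_succ_iff, Cardinal.succ_aleph0, ← Cardinal.lt_ord, Cardinal.ord_aleph]
  exact h

variable {X : Type u} {Θ : Type v}

/-- The codes `c` describe, by means of the enumeration `F` of the graph of a parametrized class, a
Littlestone tree of depth `n` together with a parameter for each word of length at most `n`, and
the hypotheses that follow a branch have dimension at least `α`. -/
def IsTreeCode (F : (ℕ → ℕ) → Θ × X × Bool) (H : Set (X → Bool)) (n : ℕ) (α : Ordinal.{u})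
    (c : List Bool → ℕ → ℕ → ℕ) : Prop :=
  ∃ (x : List Bool → X) (θ : List Bool → Θ),
    (∀ p : List Bool, p.length ≤ n → ∀ (k : ℕ) (hk : k < p.length),
      F (c p k) = (θ p, x (p.take k), p[k])) ∧
    ∀ p : List Bool, p.length = n →
      LdimGE α {h | h ∈ H ∧ ∀ (k : ℕ) (hk : k < p.length), h (x (p.take k)) = p[k]}

/-- The part of the codes `c` that is fixed at depth `n`. -/
def truncateCode (n : ℕ) (c : List Bool → ℕ → ℕ → ℕ) :
    {p : List Bool // p.length ≤ n} → Fin n → Fin n → ℕ :=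
  fun p k i => c p k i

theorem truncateCode_of_le {m n : ℕ} (h : m ≤ n) {c d : List Bool → ℕ → ℕ → ℕ}
    (hcd : truncateCode n c = truncateCode n d) : truncateCode m c = truncateCode m d := by
  ext p k i
  exact congrFun (congrFun (congrFun hcd ⟨p, p.2.trans h⟩) (k.castLE h)) (i.castLE h)

theorem countable_truncateCode (n : ℕ) :
    Countable ({p : List Bool // p.length ≤ n} → Fin n → Fin n → ℕ) := by
  have : Finite {p : List Bool // p.length ≤ n} := List.finite_length_le Bool n
  infer_instance

variable {g : Θ × X → Bool} {F : (ℕ → ℕ) → Θ × X × Bool}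

/-- One unit of dimension pays for one more level: the points splitting the classes at depth `n`
become the new nodes, and the nonempty classes below them supply the new parameters. -/
theorem IsTreeCode.exists_succ {H : Set (X → Bool)} (hH : H = Set.range fun θ x => g (θ, x))
    (hF : Set.range F = {q | g (q.1, q.2.1) = q.2.2}) {n : ℕ} {α : Ordinal.{u}}
    {c : List Bool → ℕ → ℕ → ℕ} (hc : IsTreeCode F H n (Order.succ α) c) :
    ∃ c', IsTreeCode F H (n + 1) α c' ∧ truncateCode n c' = truncateCode n c := by
  obtain ⟨x, θ, hcode, hdim⟩ := hc
  have : Nonempty X := ⟨(ldimGE_succ.1 (hdim (List.replicate n true) (by simp))).choose⟩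
  choose! z hz using fun p hp => ldimGE_succ.1 (hdim p hp)
  let x' : List Bool → X := fun p => if p.length = n then z p else x p
  have hx' : ∀ p : List Bool, p.length = n + 1 → ∀ k < n, x' (p.take k) = x (p.take k) := by
    intro p hp k hk
    exact if_neg (by simp; omega)
  have hdim' : ∀ p : List Bool, p.length = n + 1 →
      LdimGE α {h | h ∈ H ∧ ∀ (k : ℕ) (hk : k < p.length), h (x' (p.take k)) = p[k]} := by
    intro p hp
    have hlen : (p.take n).length = n := by simp; omega
    refine (hz (p.take n) hlen p[n]).mono fun h ⟨⟨hH, hh⟩, hn⟩ => ⟨hH, fun k hk => ?_⟩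
    rcases Nat.lt_succ_iff_lt_or_eq.1 (hk.trans_eq hp) with hkn | rfl
    · rw [hx' p hp k hkn]
      have := hh k (hkn.trans_eq hlen.symm)
      rw [List.take_take, min_eq_left hkn.le] at this
      simpa using this
    · simpa [x', hlen] using hn
  have hθ : ∀ p : List Bool, ∃ ϑ, p.length = n + 1 → ∀ (k : ℕ) (hk : k < p.length),
      g (ϑ, x' (p.take k)) = p[k] := by
    intro p
    by_cases hp : p.length = n + 1
    · obtain ⟨h, hh, hhp⟩ := (hdim' p hp).nonempty
      rw [hH] at hh
      obtain ⟨ϑ, rfl⟩ := hh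
      exact ⟨ϑ, fun _ => hhp⟩
    · exact ⟨θ p, fun h => absurd h hp⟩
  choose ϑ hϑ using hθ
  have hd : ∀ (p : List Bool) (k : ℕ), ∃ d, p.length = n + 1 → ∀ hk : k < p.length,
      F d = (ϑ p, x' (p.take k), p[k]) := by
    intro p k
    by_cases hp : p.length = n + 1 ∧ k < p.length
    · have : (ϑ p, x' (p.take k), p[k]) ∈ Set.range F := by
        rw [hF]
        exact hϑ p hp.1 k hp.2
      obtain ⟨d, hd⟩ := this
      exact ⟨d, fun _ _ => hd⟩
    · exact ⟨0, fun h₁ h₂ => absurd ⟨h₁, h₂⟩ hp⟩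
  choose d hd using hd
  refine ⟨fun p k => if p.length ≤ n then c p k else d p k,
    ⟨x', fun p => if p.length ≤ n then θ p else ϑ p, fun p hp k hk => ?_, hdim'⟩, ?_⟩
  · by_cases hpn : p.length ≤ n
    · have : x' (p.take k) = x (p.take k) := if_neg (by simp; omega)
      simp only [hpn, if_true, this]
      exact hcode p hpn k hk
    · simp only [hpn, if_false]
      exact hd p k (by omega) hk
  · ext p k i
    simp [truncateCode, p.2]

/-- There are only countably many truncations at each depth, so one of them is shared by codes for
all countable ordinals; that one can be extended again. -/
theorem exists_seq_isTreeCode {H : Set (X → Bool)} (hH : H = Set.range fun θ x => g (θ, x))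
    (hF : Set.range F = {q | g (q.1, q.2.1) = q.2.2}) (hdim : ∀ α < ω₁, LdimGE α H) :
    ∃ c : ℕ → List Bool → ℕ → ℕ → ℕ, (∀ n, IsTreeCode F H n 0 (c n)) ∧
      ∀ m n, m ≤ n → truncateCode m (c n) = truncateCode m (c m) := by
  have hpos : (0 : Ordinal.{u}) < ω₁ := omega0_pos.trans omega0_lt_omega_one
  -- The codes `c` may vary with `α`; only their truncation is common.
  let Good : ℕ → (List Bool → ℕ → ℕ → ℕ) → Prop := fun n d =>
    IsTreeCode F H n 0 d ∧ ∀ α < ω₁, ∃ c, IsTreeCode F H n α c ∧ truncateCode n c = truncateCode n d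
  have hmono : ∀ {n α β c}, β ≤ α → IsTreeCode F H n α c → IsTreeCode F H n β c := by
    rintro n α β c hβ ⟨x, θ, h₁, h₂⟩
    exact ⟨x, θ, h₁, fun p hp => (h₂ p hp).of_le hβ⟩
  have step : ∀ n d, Good n d → ∃ d', Good (n + 1) d' ∧ truncateCode n d' = truncateCode n d := by
    rintro n d ⟨-, hd⟩
    have := countable_truncateCode (n + 1)
    obtain ⟨κ, hκ⟩ := exists_forall_lt_omega_one (ι := {p : List Bool // p.length ≤ n + 1} →
        Fin (n + 1) → Fin (n + 1) → ℕ)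
      (Q := fun κ α => ∃ c, IsTreeCode F H (n + 1) α c ∧ truncateCode n c = truncateCode n d ∧
        truncateCode (n + 1) c = κ)
      (fun κ α β hβ ⟨c, hc, h⟩ => ⟨c, hmono hβ hc, h⟩) (fun α hα => by
        obtain ⟨c, hc, hcd⟩ := hd _ (succ_lt_omega_one hα)
        obtain ⟨c', hc', hcc'⟩ := hc.exists_succ hH hF
        exact ⟨_, c', hc', hcc'.trans hcd, rfl⟩)
    obtain ⟨d', hd', hdd', hκd'⟩ := hκ 0 hpos
    refine ⟨d', ⟨hd', fun α hα => ?_⟩, hdd'⟩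
    obtain ⟨c, hc, -, hκc⟩ := hκ α hα
    exact ⟨c, hc, hκc.trans hκd'.symm⟩
  have hroot : ∃ d, Good 0 d := by
    obtain ⟨x, -⟩ := (ldimGE_iff.1 (hdim _ (succ_lt_omega_one hpos))).2 0 (Order.lt_succ 0)
    obtain ⟨h, hh⟩ := (hdim 0 hpos).nonempty
    rw [hH] at hh
    obtain ⟨θ, -⟩ := hh
    have h0 : ∀ α < ω₁, IsTreeCode F H 0 α 0 := by
      refine fun α hα => ⟨fun _ => x, fun _ => θ, fun p hp k hk => absurd hk (by omega),
        fun p hp => (hdim α hα).mono fun h hh => ⟨hh, fun k hk => absurd hk (by omega)⟩⟩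
    exact ⟨0, h0 0 hpos, fun α hα => ⟨0, h0 α hα, rfl⟩⟩
  obtain ⟨d₀, hd₀⟩ := hroot
  choose! s hs using step
  let c : ℕ → List Bool → ℕ → ℕ → ℕ := fun n => Nat.rec d₀ s n
  have hc : ∀ n, Good n (c n) := by
    intro n
    induction n with
    | zero => exact hd₀
    | succ n ih => exact (hs n _ ih).1
  refine ⟨c, fun n => (hc n).1, fun m n hmn => ?_⟩
  induction n, hmn using Nat.le_induction with
  | base => rfl
  | succ n hmn ih => exact (truncateCode_of_le hmn (hs n _ (hc n)).2).trans ih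

open Filter Topology in
/-- A parametrized class whose dimension is at least each countable ordinal shatters an infinite
Littlestone tree. -/
theorem shattersInfiniteLittlestoneTree_of_forall_lt_omega_one [TopologicalSpace X] [PolishSpace X]
    [MeasurableSpace X] [BorelSpace X] {H : Set (X → Bool)}
    (hH : HasMeasurableParametrization.{u, v} H) (hdim : ∀ α < ω₁, LdimGE α H) :
    ShattersInfiniteLittlestoneTree H := by
  obtain ⟨Θ, _, _, _, _, g, hg, hH⟩ := hH
  have hgraph : MeasurableSet {q : Θ × X × Bool | g (q.1, q.2.1) = q.2.2} :=
    measurableSet_eq_fun (by fun_prop) (by fun_prop)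
  have hne : {q : Θ × X × Bool | g (q.1, q.2.1) = q.2.2}.Nonempty := by
    have hpos : (0 : Ordinal.{u}) < ω₁ := omega0_pos.trans omega0_lt_omega_one
    obtain ⟨x, hx⟩ := (ldimGE_iff.1 (hdim _ (succ_lt_omega_one hpos))).2 0 (Order.lt_succ 0)
    obtain ⟨h, hh, -⟩ := (hx true).nonempty
    rw [hH] at hh
    obtain ⟨θ, -⟩ := hh
    exact ⟨(θ, x, g (θ, x)), rfl⟩
  have := hgraph.analyticSet
  rw [AnalyticSet] at this
  obtain ⟨F, hFc, hF⟩ := this.resolve_left hne.ne_empty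
  obtain ⟨c, hc, hcc⟩ := exists_seq_isTreeCode hH hF hdim
  choose x θ hcode _ using hc
  -- The depth exceeds `k` and `i` and is at least the length of `p`, so this entry no longer
  -- changes from there on.
  let l : List Bool → ℕ → ℕ → ℕ := fun p k i => c (p.length + k + i + 1) p k i
  have hl : ∀ p k, Tendsto (fun n => F (c n p k)) atTop (𝓝 (F (l p k))) := by
    intro p k
    refine (hFc.tendsto _).comp (tendsto_pi_nhds.2 fun i => tendsto_nhds_of_eventually_eq ?_)
    filter_upwards [eventually_ge_atTop (p.length + k + i + 1)] with n hn
    exact congrFun (congrFun (congrFun (hcc _ n hn) ⟨p, by omega⟩) ⟨k, by omega⟩) ⟨i, by omega⟩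
  have hev : ∀ (p : List Bool) (k : ℕ) (hk : k < p.length),
      ∀ᶠ n in atTop, F (c n p k) = (θ n p, x n (p.take k), p[k]) := by
    intro p k hk
    filter_upwards [eventually_ge_atTop p.length] with n hn
    exact hcode n p hn k hk
  have hlabel : ∀ (p : List Bool) (k : ℕ) (hk : k < p.length), (F (l p k)).2.2 = p[k] := by
    intro p k hk
    refine tendsto_nhds_unique ((hl p k).snd_nhds.snd_nhds) (tendsto_nhds_of_eventually_eq ?_)
    filter_upwards [hev p k hk] with n hn
    rw [hn]
  have hparam : ∀ (p : List Bool) (k j : ℕ), k < p.length → j < p.length →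
      (F (l p k)).1 = (F (l p j)).1 := by
    intro p k j hk hj
    refine tendsto_nhds_unique ((hl p k).fst_nhds) ((hl p j).fst_nhds.congr' ?_)
    filter_upwards [hev p k hk, hev p j hj] with n hn hn'
    rw [hn, hn']
  have hpoint : ∀ (p q : List Bool) (k j : ℕ), k < p.length → j < q.length →
      p.take k = q.take j → (F (l p k)).2.1 = (F (l q j)).2.1 := by
    intro p q k j hk hj h
    refine tendsto_nhds_unique ((hl p k).snd_nhds.fst_nhds)
      ((hl q j).snd_nhds.fst_nhds.congr' ?_)
    filter_upwards [hev p k hk, hev q j hj] with n hn hn'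
    rw [hn, hn', h]
  -- A node is read off from any word properly extending it; the letter `true` is arbitrary.
  refine ⟨fun η => (F (l (η ++ [true]) η.length)).2.1, fun p => ?_⟩
  refine ⟨fun x => g ((F (l p 0)).1, x), by rw [hH]; exact ⟨_, rfl⟩, fun k hk => ?_⟩
  have hmem : F (l p k) ∈ {q : Θ × X × Bool | g (q.1, q.2.1) = q.2.2} := by
    rw [← hF]; exact Set.mem_range_self _
  have hk' : (p.take k).length = k := by simp; omega
  show g ((F (l p 0)).1, (F (l (p.take k ++ [true]) (p.take k).length)).2.1) = p[k]
  rw [hparam p 0 k (by omega) hk, hpoint (p.take k ++ [true]) p (p.take k).length k (by simp) hk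
    (by simp), ← hlabel p k hk]
  exact hmem

end CountableBound

/-! ### Universal measurability of the SOA -/

section Measurability

variable {X : Type u} {H : Set (X → Bool)}

theorem restrictClass_versionSpace {n : ℕ} (S : Fin n → X × Bool) (x : X) (y : Bool) :
    restrictClass (versionSpace H S) x y =
      versionSpace H (Fin.snoc S (x, y) : Fin (n + 1) → X × Bool) := by
  ext h
  simp [restrictClass, versionSpace, Fin.forall_fin_succ', and_assoc]

variable [TopologicalSpace X] [PolishSpace X] [MeasurableSpace X] [BorelSpace X]

-- The quantifier over points is a projection, and the one over `β < α` is a countable intersection;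
-- both preserve analyticity.
open Ordinal in
theorem analyticSet_ldimGE_versionSpace (hH : HasMeasurableParametrization.{u, v} H)
    {α : Ordinal.{u}} (hα : α < ω₁) (n : ℕ) :
    AnalyticSet {S : Fin n → X × Bool | LdimGE α (versionSpace H S)} := by
  induction α using WellFoundedLT.induction generalizing n with
  | ind α ih =>
    have hbase : AnalyticSet {S : Fin n → X × Bool | (versionSpace H S).Nonempty} := by
      obtain ⟨Θ, _, _, _, _, g, hg, hH⟩ := hH
      have hm : MeasurableSet
          {q : Θ × (Fin n → X × Bool) | ∀ i, g (q.1, (q.2 i).1) = (q.2 i).2} := by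
        simp only [Set.ofPred_forall]
        exact .iInter fun i => measurableSet_eq_fun (by fun_prop) (by fun_prop)
      convert hm.analyticSet.image_of_continuous continuous_snd
      ext S
      simp [versionSpace, Set.Nonempty, hH]
    have hstep : ∀ β < α, AnalyticSet {S : Fin n → X × Bool |
        ∃ x, ∀ y, LdimGE β (restrictClass (versionSpace H S) x y)} := by
      intro β hβ
      have h := AnalyticSet.iInter fun y : Bool => (ih β hβ (hβ.trans hα) (n + 1)).preimage
        (f := fun q : (Fin n → X × Bool) × X => (Fin.snoc q.1 (q.2, y) : Fin (n + 1) → X × Bool))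
        (by fun_prop)
      convert h.image_of_continuous continuous_fst
      ext S
      simp [restrictClass_versionSpace]
    have := countable_Iio_of_lt_omega_one hα
    -- The index `none` stands for the nonemptiness condition.
    have hall : {S : Fin n → X × Bool | LdimGE α (versionSpace H S)} =
        ⋂ o : Option (Set.Iio α), o.elim {S | (versionSpace H S).Nonempty}
          fun β => {S | ∃ x, ∀ y, LdimGE β.1 (restrictClass (versionSpace H S) x y)} := by
      ext S
      simp [ldimGE_iff (α := α), Option.forall]
    rw [hall]
    refine AnalyticSet.iInter fun o => ?_
    cases o with
    | none => exact hbase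
    | some β => exact hstep β.1 β.2

/-- A strict inequality is witnessed by an ordinal below a countable bound, so the set is a
countable union of differences of analytic sets. -/
theorem nullMeasurableSet_ordinalLdim_lt (hH : Countable X ∨ HasMeasurableParametrization.{u, v} H)
    (htree : ¬ ShattersInfiniteLittlestoneTree H) {Ω : Type*} [TopologicalSpace Ω] [PolishSpace Ω]
    [MeasurableSpace Ω] [BorelSpace Ω] (hΩ : Countable X → Countable Ω) {m n : ℕ}
    {φ : Ω → Fin m → X × Bool} {ψ : Ω → Fin n → X × Bool} (hφ : Continuous φ) (hψ : Continuous ψ)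
    (μ : Measure Ω) [IsFiniteMeasure μ] :
    NullMeasurableSet
      {q | ordinalLdim (versionSpace H (φ q)) < ordinalLdim (versionSpace H (ψ q))} μ := by
  rcases hH with hX | hH
  · have := hΩ hX
    exact (Set.to_countable _).measurableSet.nullMeasurableSet
  obtain ⟨α, hα, hαH⟩ : ∃ α < Ordinal.omega 1, ¬ LdimGE α H := by
    by_contra! h
    exact htree (shattersInfiniteLittlestoneTree_of_forall_lt_omega_one hH h)
  have := countable_Iio_of_lt_omega_one hα
  have hU : {q | ordinalLdim (versionSpace H (φ q)) < ordinalLdim (versionSpace H (ψ q))} =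
      ⋃ β : Set.Iio α, ψ ⁻¹' {S | LdimGE β.1 (versionSpace H S)} \
        φ ⁻¹' {S | LdimGE β.1 (versionSpace H S)} := by
    ext q
    simp only [Set.mem_ofPred_eq, ordinalLdim_lt_ordinalLdim, Set.mem_iUnion, Set.mem_sdiff,
      Set.mem_preimage, Subtype.exists, Set.mem_Iio, exists_prop]
    refine exists_congr fun β => ⟨fun h => ⟨?_, h⟩, fun h => h.2⟩
    exact lt_of_not_ge fun hβ => hαH ((h.1.mono fun _ hh => hh.1).of_le hβ)
  rw [hU]
  refine .iUnion fun β => ?_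
  have hβ : ∀ k, AnalyticSet {S : Fin k → X × Bool | LdimGE β.1 (versionSpace H S)} :=
    analyticSet_ldimGE_versionSpace hH (β.2.trans hα)
  exact (((hβ n).preimage hψ).nullMeasurableSet μ).diff (((hβ m).preimage hφ).nullMeasurableSet μ)

/-- If `H` does not shatter an infinite Littlestone tree, its ordinal SOA is universally
measurable. -/
theorem universallyMeasurable_ordinalSOA
    (hH : Countable X ∨ HasMeasurableParametrization.{u, v} H)
    (htree : ¬ ShattersInfiniteLittlestoneTree H) : (ordinalSOA H).UniversallyMeasurable := by
  intro n μ _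
  obtain ⟨α, hα⟩ := exists_not_ldimGE htree
  have hfalse : (fun q : (Fin n → X × Bool) × X => ordinalSOA H n q.1 q.2) ⁻¹' {false} =
      {q | ordinalLdim (versionSpace H (Fin.snoc q.1 (q.2, true) : Fin (n + 1) → X × Bool)) <
        ordinalLdim (versionSpace H (Fin.snoc q.1 (q.2, false) : Fin (n + 1) → X × Bool))} := by
    ext ⟨S, x⟩
    have htop : ordinalLdim (restrictClass (versionSpace H S) x false) ≠ ⊤ := fun h =>
      hα ((ordinalLdim_eq_top.1 h α).mono fun _ hh => hh.1.1)
    simp [ordinalSOA, htop, ← restrictClass_versionSpace]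
  have hm := nullMeasurableSet_ordinalLdim_lt hH htree (Ω := (Fin n → X × Bool) × X)
    (fun _ => inferInstance) (φ := fun q => (Fin.snoc q.1 (q.2, true) : Fin (n + 1) → X × Bool))
    (ψ := fun q => (Fin.snoc q.1 (q.2, false) : Fin (n + 1) → X × Bool)) (by fun_prop)
    (by fun_prop) μ
  rw [← hfalse] at hm
  have htrue : (fun q : (Fin n → X × Bool) × X => ordinalSOA H n q.1 q.2) ⁻¹' {true} =
      ((fun q : (Fin n → X × Bool) × X => ordinalSOA H n q.1 q.2) ⁻¹' {false})ᶜ := by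
    ext q
    simp
  have hmtrue : NullMeasurableSet ((fun q : (Fin n → X × Bool) × X => ordinalSOA H n q.1 q.2) ⁻¹'
      {true}) μ := htrue ▸ hm.compl
  exact measurable_to_bool (α := NullMeasurableSpace ((Fin n → X × Bool) × X) μ) hmtrue

end Measurability

/-! ### Later examples hit sections of positive measure -/

section Sampling

open ProbabilityTheory Filter

variable {Z : Type u} [MeasurableSpace Z] (D : Measure Z) [IsProbabilityMeasure D]

theorem ae_exists_mem_of_measure_ne_zero {C : Set Z} (hC : MeasurableSet C) (hD : D C ≠ 0) :
    ∀ᵐ w ∂(Measure.infinitePi fun _ : ℕ => D), ∃ m, w m ∈ C := by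
  have hlt : D Cᶜ < 1 := by
    rw [prob_compl_eq_one_sub hC]
    exact ENNReal.sub_lt_self ENNReal.one_ne_top one_ne_zero hD
  refine le_antisymm (ge_of_tendsto' (ENNReal.tendsto_pow_atTop_nhds_zero_of_lt_one hlt)
    fun n => ?_) zero_le
  calc _ ≤ Measure.infinitePi (fun _ : ℕ => D) (Set.pi (Finset.range n) fun _ => Cᶜ) :=
        measure_mono fun w (hw : ¬ ∃ m, w m ∈ C) i _ hi => hw ⟨i, hi⟩
    _ = D Cᶜ ^ n := by
        rw [Measure.infinitePi_pi _ fun _ _ => hC.compl]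
        simp

/-- The first `N` terms of an i.i.d. sequence are independent of the rest, which is again an i.i.d.
sequence. -/
theorem infinitePi_map_head_tail (N : ℕ) :
    (Measure.infinitePi fun _ : ℕ => D).map
        (fun z => ((fun i : Fin N => z i), fun k : ℕ => z (N + k))) =
      (Measure.pi fun _ : Fin N => D).prod (Measure.infinitePi fun _ : ℕ => D) := by
  have hind : iIndepFun (fun (i : ℕ) (z : ℕ → Z) => z i) (Measure.infinitePi fun _ : ℕ => D) :=
    iIndepFun_infinitePi (X := fun _ x => x) fun _ => measurable_id
  have hmeas : ∀ i, Measurable fun z : ℕ → Z => z i := fun i => measurable_pi_apply i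
  have hdisj : Disjoint {i : ℕ | i < N} {i | N ≤ i} :=
    Set.disjoint_left.2 fun i (hi : i < N) (hi' : N ≤ i) => by omega
  have h := indep_iSup_of_disjoint (fun i => (hmeas i).comap_le) hind hdisj
  have hpair : IndepFun (fun (z : ℕ → Z) (i : Fin N) => z i) (fun z (k : ℕ) => z (N + k))
      (Measure.infinitePi fun _ : ℕ => D) := by
    rw [IndepFun_iff_Indep]
    refine indep_of_indep_of_le_left (indep_of_indep_of_le_right h ?_) ?_
    · rw [← measurable_iff_comap_le]
      refine @measurable_pi_lambda _ _ _ (_) _ _ fun k => ?_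
      exact Measurable.mono (comap_measurable fun z : ℕ → Z => z (N + k))
        (le_iSup₂_of_le (f := fun i (_ : i ∈ {i | N ≤ i}) => MeasurableSpace.comap
          (fun z : ℕ → Z => z i) _) (N + k) (Nat.le_add_right N k) le_rfl) le_rfl
    · rw [← measurable_iff_comap_le]
      refine @measurable_pi_lambda _ _ _ (_) _ _ fun k => ?_
      exact Measurable.mono (comap_measurable fun z : ℕ → Z => z k)
        (le_iSup₂_of_le (f := fun i (_ : i ∈ {i | i < N}) => MeasurableSpace.comap
          (fun z : ℕ → Z => z i) _) k k.2 le_rfl) le_rfl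
  rw [(indepFun_iff_map_prod_eq_prod_map_map (by fun_prop : Measurable _).aemeasurable
    (by fun_prop : Measurable _).aemeasurable).1 hpair]
  congr 1
  · rw [Measure.map_infinitePi_infinitePi_of_inj (P := fun _ : ℕ => D) (f := fun i : Fin N => (i : ℕ))
      Fin.val_injective, Measure.infinitePi_eq_pi]
  · exact Measure.map_infinitePi_infinitePi_of_inj (P := fun _ : ℕ => D) (f := fun k => N + k)
      (add_right_injective N)

/-- If the section of a set at the first `N` terms of an i.i.d. sequence is not null, a later term
lies in this section. -/
theorem ae_exists_mem_section {N : ℕ} {B : Set ((Fin N → Z) × Z)}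
    (hB : NullMeasurableSet B ((Measure.pi fun _ : Fin N => D).prod D)) :
    ∀ᵐ z ∂(Measure.infinitePi fun _ : ℕ => D), D {w | ((fun i : Fin N => z i), w) ∈ B} ≠ 0 →
      ∃ m ≥ N, ((fun i : Fin N => z i), z m) ∈ B := by
  -- Fubini is applied to a measurable core `C`, almost all of whose sections have the same measure
  -- as those of `B`.
  obtain ⟨C, hCB, hC, hCae⟩ := hB.exists_measurable_subset_ae_eq
  have hsec : ∀ᵐ S ∂(Measure.pi fun _ : Fin N => D), D {w | (S, w) ∈ B} = D {w | (S, w) ∈ C} := by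
    filter_upwards [Measure.ae_ae_of_ae_prod (eventuallyEq_set.1 hCae)] with S hS
    exact measure_congr (eventuallyEq_set.2 (hS.mono fun _ h => h.symm))
  have hE : MeasurableSet {q : (Fin N → Z) × (ℕ → Z) |
      D {w | (q.1, w) ∈ C} = 0 ∨ ∃ k, (q.1, q.2 k) ∈ C} := by
    refine MeasurableSet.union (s₁ := {q : (Fin N → Z) × (ℕ → Z) | D {w | (q.1, w) ∈ C} = 0})
      (s₂ := {q : (Fin N → Z) × (ℕ → Z) | ∃ k, (q.1, q.2 k) ∈ C}) ?_ ?_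
    · exact ((measurable_measure_prodMk_left hC).comp measurable_fst) (measurableSet_singleton 0)
    · simp only [Set.ofPred_exists]
      exact .iUnion fun k => hC.preimage (by fun_prop)
  have hC' : ∀ᵐ q ∂((Measure.pi fun _ : Fin N => D).prod (Measure.infinitePi fun _ : ℕ => D)),
      D {w | (q.1, w) ∈ C} = 0 ∨ ∃ k, (q.1, q.2 k) ∈ C := by
    rw [Measure.ae_prod_iff_ae_ae hE]
    refine .of_forall fun S => ?_
    by_cases h0 : D {w | (S, w) ∈ C} = 0
    · exact .of_forall fun w => .inl h0
    · filter_upwards [ae_exists_mem_of_measure_ne_zero D (hC.preimage measurable_prodMk_left) h0]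
        with w hw using .inr hw
  have hall : ∀ᵐ q ∂((Measure.pi fun _ : Fin N => D).prod (Measure.infinitePi fun _ : ℕ => D)),
      D {w | (q.1, w) ∈ B} ≠ 0 → ∃ k, (q.1, q.2 k) ∈ B := by
    filter_upwards [hC', Measure.quasiMeasurePreserving_fst.ae hsec] with q hq hq' h0
    obtain ⟨k, hk⟩ := hq.resolve_left (hq' ▸ h0)
    exact ⟨k, hCB hk⟩
  rw [← infinitePi_map_head_tail] at hall
  filter_upwards [ae_of_ae_map (by fun_prop) hall] with z hz h0
  obtain ⟨k, hk⟩ := hz h0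
  exact ⟨N + k, Nat.le_add_right N k, hk⟩

end Sampling

/-! ### The SOA is a PEC learner -/

section Learner

variable {X : Type u} {H : Set (X → Bool)}

/-- The samples from a realizable distribution are consistent with the class. -/
theorem ae_nonempty_versionSpace [MeasurableSpace X] {D : Measure (X × Bool)}
    [IsProbabilityMeasure D] (hD : IsRealizable H D) :
    ∀ᵐ z ∂(Measure.infinitePi fun _ : ℕ => D),
      ∀ n, (versionSpace H fun i : Fin n => z i).Nonempty := by
  refine ae_all_iff.2 fun n => ?_
  have hle : ∀ h ∈ H, Measure.infinitePi (fun _ : ℕ => D)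
      {z | ¬ (versionSpace H fun i : Fin n => z i).Nonempty} ≤ n * loss D h := by
    intro h hh
    have hsub : {z : ℕ → X × Bool | ¬ (versionSpace H fun i : Fin n => z i).Nonempty} ⊆
        ⋃ i : Fin n, (fun z : ℕ → X × Bool => z i) ⁻¹' {w | h w.1 ≠ w.2} := by
      intro z hz
      by_contra hz'
      simp only [Set.mem_iUnion, Set.mem_preimage, Set.mem_ofPred_eq, not_exists, not_not] at hz'
      exact hz ⟨h, hh, hz'⟩
    refine (measure_mono hsub).trans ((measure_iUnion_le _).trans ?_)
    rw [tsum_fintype]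
    refine (Finset.sum_le_sum (g := fun _ => loss D h) fun i _ => ?_).trans (by simp)
    -- This inequality holds for arbitrary sets, and `h` need not be measurable.
    refine (Measure.le_map_apply (measurable_pi_apply (i : ℕ)).aemeasurable _).trans ?_
    rw [Measure.infinitePi_map_eval]
    exact le_rfl
  rw [ae_iff]
  by_contra h0
  have hpos : 0 < Measure.infinitePi (fun _ : ℕ => D)
      {z | ¬ (versionSpace H fun i : Fin n => z i).Nonempty} / n :=
    ENNReal.div_pos h0 (ENNReal.natCast_ne_top n)
  rw [← hD] at hpos
  obtain ⟨h, hlt⟩ := iInf_lt_iff.1 hpos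
  obtain ⟨hh, hlt⟩ := iInf_lt_iff.1 hlt
  have := ENNReal.mul_lt_of_lt_div' hlt
  exact absurd (hle h hh) (not_le.2 this)

variable [TopologicalSpace X] [PolishSpace X] [MeasurableSpace X] [BorelSpace X]

/-- If `H` does not shatter an infinite Littlestone tree, its ordinal SOA is a PEC learner. -/
theorem isPECLearner_ordinalSOA (hH : Countable X ∨ HasMeasurableParametrization.{u, v} H)
    (htree : ¬ ShattersInfiniteLittlestoneTree H) : IsPECLearner (ordinalSOA H) H := by
  intro D _ hD
  obtain ⟨α, hα⟩ := exists_not_ldimGE htree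
  let B : ∀ n : ℕ, Set ((Fin n → X × Bool) × X × Bool) := fun n =>
    {q | ordinalLdim (restrictClass (versionSpace H q.1) q.2.1 q.2.2) <
      ordinalLdim (versionSpace H q.1)}
  have hB : ∀ n, NullMeasurableSet (B n) ((Measure.pi fun _ : Fin n => D).prod D) := by
    intro n
    simp only [B, restrictClass_versionSpace]
    exact nullMeasurableSet_ordinalLdim_lt hH htree (fun _ => inferInstance)
      (φ := fun q : (Fin n → X × Bool) × X × Bool =>
        (Fin.snoc q.1 (q.2.1, q.2.2) : Fin (n + 1) → X × Bool))
      (by fun_prop) continuous_fst _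
  filter_upwards [ae_nonempty_versionSpace hD,
    ae_all_iff.2 fun n => ae_exists_mem_section D (hB n)] with z hne hz
  let V : ℕ → Set (X → Bool) := fun n => versionSpace H fun i : Fin n => z i
  have hV : Antitone V := fun m n hmn h hh => ⟨hh.1, fun i => hh.2 (i.castLE hmn)⟩
  obtain ⟨N, hN⟩ : ∃ N, ∀ m, ordinalLdim (V N) ≤ ordinalLdim (V m) := by
    obtain ⟨_, ⟨N, rfl⟩, hN⟩ := WellFounded.has_min (r := (· < ·)) wellFounded_lt
      (Set.range fun n => ordinalLdim (V n)) (Set.range_nonempty _)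
    exact ⟨N, fun m => not_lt.1 (hN _ ⟨m, rfl⟩)⟩
  refine ⟨N, fun n hn => ?_⟩
  have hBn : D {w | ((fun i : Fin n => z i), w) ∈ B n} = 0 := by
    by_contra h0
    obtain ⟨m, hmn, hm⟩ := hz n h0
    have hlt : ordinalLdim (restrictClass (V n) (z m).1 (z m).2) < ordinalLdim (V n) := hm
    -- `V (m + 1)` satisfies all constraints of `V n` and also that of example `m`, so its dimension
    -- lies below the minimum.
    refine absurd (hN (m + 1)) (not_le.2 ?_)
    refine lt_of_le_of_lt (ordinalLdim_mono fun h hh => ?_)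
      (hlt.trans_le (ordinalLdim_mono (hV hn)))
    exact ⟨hV (hmn.trans (Nat.le_succ m)) hh, hh.2 (Fin.last m)⟩
  exact measure_mono_null
    (fun w hw => ordinalLdim_restrictClass_lt_of_ordinalSOA_ne (hne n) hα hw) hBn

end Learner

/-! ### A tree defeats every learning rule -/

section LowerBound

open ProbabilityTheory Filter

theorem measurableSet_of_forall_lt {s : Set (ℕ → Bool)} (M : ℕ)
    (hs : ∀ y y' : ℕ → Bool, (∀ i < M, y i = y' i) → y ∈ s → y' ∈ s) : MeasurableSet s := by
  let f : (ℕ → Bool) → Fin M → Bool := fun y i => y i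
  have : s = f ⁻¹' (f '' s) := by
    refine Set.Subset.antisymm (Set.subset_preimage_image f s) ?_
    rintro y ⟨y', hy', h⟩
    exact hs y' y (fun i hi => congrFun h ⟨i, hi⟩) hy'
  rw [this]
  exact (Set.toFinite _).measurableSet.preimage (by fun_prop)

/-- The distribution of a fair coin. -/
noncomputable def fairCoin : Measure Bool :=
  (2 : ENNReal)⁻¹ • (Measure.dirac true + Measure.dirac false)

instance : IsProbabilityMeasure fairCoin :=
  ⟨by simp [fairCoin, ← two_mul, ENNReal.mul_inv_cancel]⟩

theorem map_not_fairCoin : fairCoin.map not = fairCoin := by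
  rw [fairCoin, Measure.map_smul, Measure.map_add _ _ (measurable_of_countable not),
    Measure.map_dirac, Measure.map_dirac, add_comm]
  rfl

/-- A guess that depends only on the first `M` tosses of a fair coin is wrong about the next toss with
probability `1 / 2`. -/
theorem measure_ne_fairCoin {M : ℕ} {e : (ℕ → Bool) → Bool}
    (he : ∀ y y' : ℕ → Bool, (∀ i < M, y i = y' i) → e y = e y') :
    Measure.infinitePi (fun _ : ℕ => fairCoin) {y | e y ≠ y M} = 2⁻¹ := by
  set Q := Measure.infinitePi fun _ : ℕ => fairCoin
  have hs : MeasurableSet {y | e y ≠ y M} := by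
    refine measurableSet_of_forall_lt (M + 1) fun y y' h hy => ?_
    rwa [Set.mem_ofPred_eq, ← he y y' fun i hi => h i (hi.trans (Nat.lt_succ_self M)),
      ← h M (Nat.lt_succ_self M)]
  have hflip : ∀ i, Measurable fun b : Bool => if i = M then !b else b := fun i =>
    measurable_of_countable _
  -- Flipping toss `M` preserves the measure and exchanges wrong with right guesses.
  have hQ : Q.map (fun y i => if i = M then !(y i) else y i) = Q := by
    rw [Measure.infinitePi_map_pi (fun _ => fairCoin)
      (f := fun i (b : Bool) => if i = M then !b else b) hflip]
    congr 1
    ext1 i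
    by_cases hi : i = M
    · simpa [hi] using map_not_fairCoin
    · simp [hi]
  have hcompl : Q {y | e y ≠ y M} = Q {y | e y ≠ y M}ᶜ := by
    have hf : Measurable fun (y : ℕ → Bool) i => if i = M then !(y i) else y i :=
      measurable_pi_lambda _ fun i => (hflip i).comp (measurable_pi_apply i)
    conv_lhs => rw [← hQ]
    rw [Measure.map_apply hf hs]
    congr 1
    ext y
    have : e (fun i => if i = M then !(y i) else y i) = e y := he _ _ fun i hi => by simp [hi.ne]
    simp [this]
  have h1 := prob_add_prob_compl (μ := Q) hs
  rw [← hcompl, ← mul_two] at h1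
  exact ENNReal.eq_inv_of_mul_eq_one_left h1

/-- A reverse Fatou bound: each tail union contains some `E N`, and the unions decrease. -/
theorem le_measure_iInter_iUnion {Ω : Type*} [MeasurableSpace Ω] (μ : Measure Ω) [IsFiniteMeasure μ]
    {E : ℕ → Set Ω} (hE : ∀ n, MeasurableSet (E n)) {r : ENNReal} (hr : ∀ n, r ≤ μ (E n)) :
    r ≤ μ (⋂ N, ⋃ n ≥ N, E n) := by
  rw [Antitone.measure_iInter]
  · exact le_iInf fun N => (hr N).trans
      (measure_mono (Set.subset_biUnion_of_mem (u := E) (le_refl N)))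
  · exact fun N N' h => Set.biUnion_subset_biUnion_left fun n hn => le_trans h hn
  · exact fun N => (MeasurableSet.iUnion fun n => .iUnion fun _ => hE n).nullMeasurableSet
  · exact ⟨0, measure_ne_top _ _⟩

variable {X : Type u}

/-- The `k`-th example on the branch `y` of the tree `t`. -/
def branchExample (t : List Bool → X) (y : ℕ → Bool) (k : ℕ) : X × Bool :=
  (t ((List.range k).map y), y k)

theorem branchExample_congr (t : List Bool → X) {y y' : ℕ → Bool} {k : ℕ}
    (h : ∀ i ≤ k, y i = y' i) : branchExample t y k = branchExample t y' k := by
  have : (List.range k).map y = (List.range k).map y' :=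
    List.map_congr_left fun i hi => h i (List.mem_range.1 hi).le
  rw [branchExample, branchExample, this, h k le_rfl]

/-- The learning rule errs on the first example after those that its sample can contain. -/
def ErrsBeyond (A : LearningRule X) (t : List Bool → X) {n : ℕ} (κ : Fin n → ℕ) (y : ℕ → Bool) :
    Prop :=
  A n (fun i => branchExample t y (κ i)) (branchExample t y (∑ i, κ i + 1)).1 ≠ y (∑ i, κ i + 1)

variable (A : LearningRule X) (t : List Bool → X)

theorem measure_errsBeyond {n : ℕ} (κ : Fin n → ℕ) :
    Measure.infinitePi (fun _ : ℕ => fairCoin) {y | ErrsBeyond A t κ y} = 2⁻¹ := by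
  refine measure_ne_fairCoin (e := fun y => A n (fun i => branchExample t y (κ i))
    (branchExample t y (∑ i, κ i + 1)).1) fun y y' h => ?_
  have h₁ : (fun i => branchExample t y (κ i)) = fun i => branchExample t y' (κ i) := by
    ext1 i
    refine branchExample_congr t fun j hj => h j ?_
    have := Finset.single_le_sum (f := κ) (fun _ _ => Nat.zero_le _) (Finset.mem_univ i)
    omega
  have h₂ : (List.range (∑ i, κ i + 1)).map y = (List.range (∑ i, κ i + 1)).map y' :=
    List.map_congr_left fun i hi => h i (List.mem_range.1 hi)
  simp only [h₁]
  simp only [branchExample, h₂]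

theorem measurableSet_errsBeyond (n : ℕ) :
    MeasurableSet {q : (ℕ → Bool) × (ℕ → ℕ) | ErrsBeyond A t (fun i : Fin n => q.2 i) q.1} := by
  have : {q : (ℕ → Bool) × (ℕ → ℕ) | ErrsBeyond A t (fun i : Fin n => q.2 i) q.1} =
      ⋃ κ : Fin n → ℕ, {y | ErrsBeyond A t κ y} ×ˢ {K : ℕ → ℕ | (fun i : Fin n => K i) = κ} := by
    ext q
    simp
  rw [this]
  refine .iUnion fun κ => .prod ?_ ?_
  · refine measurableSet_of_forall_lt (∑ i, κ i + 2) fun y y' h hy => ?_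
    have h₁ : (fun i => branchExample t y (κ i)) = fun i => branchExample t y' (κ i) := by
      ext1 i
      refine branchExample_congr t fun j hj => h j ?_
      have := Finset.single_le_sum (f := κ) (fun _ _ => Nat.zero_le _) (Finset.mem_univ i)
      omega
    rw [Set.mem_ofPred_eq, ErrsBeyond] at hy ⊢
    rwa [← h₁, ← branchExample_congr t fun i hi => h i (by omega), ← h _ (by omega)]
  · exact (measurableSet_singleton κ).preimage
      (f := fun (K : ℕ → ℕ) (i : Fin n) => K i) (by fun_prop)

/-- For each learning rule there is a branch of the tree on which the rule errs infinitely often with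
positive probability. -/
theorem exists_branch_not_ae_eventually (ν : Measure ℕ) [IsProbabilityMeasure ν] :
    ∃ y : ℕ → Bool, ¬ ∀ᵐ K ∂(Measure.infinitePi fun _ : ℕ => ν),
      ∃ N, ∀ n ≥ N, ¬ ErrsBeyond A t (fun i : Fin n => K i) y := by
  by_contra! h
  let E : ℕ → Set ((ℕ → Bool) × (ℕ → ℕ)) := fun n =>
    {q | ErrsBeyond A t (fun i : Fin n => q.2 i) q.1}
  have hE : ∀ n, MeasurableSet (E n) := measurableSet_errsBeyond A t
  have hhalf : ∀ n, 2⁻¹ ≤ ((Measure.infinitePi fun _ : ℕ => fairCoin).prod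
      (Measure.infinitePi fun _ : ℕ => ν)) (E n) := by
    intro n
    rw [Measure.prod_apply_symm (hE n)]
    have : ∀ K : ℕ → ℕ, Measure.infinitePi (fun _ : ℕ => fairCoin)
        ((fun y => (y, K)) ⁻¹' E n) = 2⁻¹ := fun K => measure_errsBeyond A t _
    simp [this]
  have hlim := le_measure_iInter_iUnion _ hE hhalf
  have hnull : ((Measure.infinitePi fun _ : ℕ => fairCoin).prod
      (Measure.infinitePi fun _ : ℕ => ν)) (⋂ N, ⋃ n ≥ N, E n) = 0 := by
    rw [Measure.measure_prod_null
      (.iInter fun N => .iUnion fun n => .iUnion fun _ => hE n)]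
    refine .of_forall fun y => ?_
    refine measure_mono_null (fun K hK => ?_) (ae_iff.1 (h y))
    simp only [Set.mem_preimage, Set.mem_iInter, Set.mem_iUnion] at hK
    rintro ⟨N, hN⟩
    obtain ⟨n, hn, hK⟩ := hK N
    exact hN n hn hK
  rw [hnull] at hlim
  simp at hlim

variable [MeasurableSpace X]

/-- A hypothesis following the first `N` steps of the branch errs only at depths at least `N`, whose
mass tends to `0`. -/
theorem isRealizable_map_branchExample [MeasurableSingletonClass X] {H : Set (X → Bool)}
    (ht : ∀ p : List Bool, ∃ h ∈ H, ∀ (k : ℕ) (hk : k < p.length), h (t (p.take k)) = p[k])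
    (y : ℕ → Bool) (ν : Measure ℕ) [IsFiniteMeasure ν] :
    IsRealizable H (ν.map (branchExample t y)) := by
  have htail : ⨅ N, ν (Set.Ici N) = 0 := by
    rw [← Antitone.measure_iInter (fun N N' h => Set.Ici_subset_Ici.2 h)
      (fun N => measurableSet_Ici.nullMeasurableSet) ⟨0, measure_ne_top _ _⟩]
    have : ⋂ N : ℕ, Set.Ici N = ∅ := by
      ext k
      simpa using ⟨k + 1, Nat.lt_succ_self k⟩
    rw [this, measure_empty]
  refine le_antisymm (htail ▸ le_iInf fun N => ?_) zero_le
  obtain ⟨h, hh, hp⟩ := ht ((List.range N).map y)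
  refine (iInf₂_le h hh).trans ?_
  let C : Set (X × Bool) := (branchExample t y '' Set.Iio N)ᶜ
  have hC : MeasurableSet C := ((Set.finite_Iio N).image _).measurableSet.compl
  calc loss (ν.map (branchExample t y)) h ≤ ν.map (branchExample t y) C := by
        refine measure_mono ?_
        rintro _ hz ⟨k, hk, rfl⟩
        have hk' : k < N := hk
        have := hp k (by simpa using hk')
        rw [← List.map_take, List.take_range, min_eq_left hk'.le] at this
        exact hz (by simpa [branchExample] using this)
    _ = ν (branchExample t y ⁻¹' C) := Measure.map_apply (measurable_of_countable _) hC
    _ ≤ ν (Set.Ici N) := measure_mono fun k hk => Set.mem_Ici.2 <| not_lt.1 fun hlt => hk ⟨k, hlt, rfl⟩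

theorem not_pecLearnable_of_shattersInfiniteLittlestoneTree [MeasurableSingletonClass X]
    {H : Set (X → Bool)} (hH : ShattersInfiniteLittlestoneTree H) : ¬ PECLearnable H := by
  rintro ⟨A, hA⟩
  obtain ⟨t, ht⟩ := hH
  -- Any distribution charging every natural number would do.
  let ν := poissonMeasure 1
  obtain ⟨y, hy⟩ := exists_branch_not_ae_eventually A t ν
  have hmeas : Measurable (branchExample t y) := measurable_of_countable _
  have : IsProbabilityMeasure (ν.map (branchExample t y)) :=
    Measure.isProbabilityMeasure_map hmeas.aemeasurable
  have hpec := hA _ (isRealizable_map_branchExample t ht y ν)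
  rw [← Measure.infinitePi_map_pi (fun _ => ν) fun _ => hmeas] at hpec
  refine hy ?_
  filter_upwards [ae_of_ae_map (Measurable.aemeasurable
    (measurable_pi_lambda _ fun i => hmeas.comp (measurable_pi_apply i))) hpec] with K hK
  obtain ⟨N, hN⟩ := hK
  refine ⟨N, fun n hn herr => ?_⟩
  have hle : ν {∑ i : Fin n, K i + 1} ≤ 0 := by
    rw [← hN n hn]
    refine (measure_mono ?_).trans (Measure.le_map_apply hmeas.aemeasurable _)
    rintro _ rfl
    exact herr
  refine absurd hle (not_le.2 ?_)
  rw [poissonMeasure_singleton]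
  exact ENNReal.ofReal_pos.2 (by positivity)

end LowerBound

theorem mainTheorem2 {X : Type u} [TopologicalSpace X] [PolishSpace X] [MeasurableSpace X]
    [BorelSpace X] (H : Set (X → Bool))
    (hH : Countable X ∨ HasMeasurableParametrization.{u, v} H) :
    (PECLearnable H ↔ ¬ ShattersInfiniteLittlestoneTree H) ∧
      (¬ ShattersInfiniteLittlestoneTree H →
        (ordinalSOA H).UniversallyMeasurable ∧ IsPECLearner (ordinalSOA H) H) :=
  ⟨⟨fun h htree => not_pecLearnable_of_shattersInfiniteLittlestoneTree htree h,
    fun h => ⟨_, isPECLearner_ordinalSOA hH h⟩⟩,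
    fun h => ⟨universallyMeasurable_ordinalSOA hH h, isPECLearner_ordinalSOA hH h⟩⟩
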